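/- A \emph{merge tree} $(T,f)$ is a finite rooted tree $T$ with a function $f:V(T)\to\mathbb{R}\cup\{\infty\}$ such that adjacent vertices have different values, every non-root vertex has exactly one neighbor of higher value, and the root is a degree one node and the only vertex with value $\infty$. Its \emph{leaves} are the non-root vertices of degree one. Let $|T|$ be the associated metric tree, an edge between heights $s$ and $t$ having length $|s-t|$, without the root at infinity; $f$ extends to $|T|$ by interpolation along edges. Write $x\preceq y$ for $x,y\in|T|$ if the path from $x$ to $y$ is (weakly) increasing in $f$, let $\mathrm{LCA}$ (lowest common ancestor) denote the least upper bound in this order, and put $\mathrm{depth}(w)=\sup_{u\preceq w}(f(w)-f(u))$. Two merge trees that differ by subdividing edges are regarded as the same. For merge trees $(T,f),(T',f')$ and $\delta\in\mathbb{R}$, a map $\alpha:|T|\to|T'|$ is \emph{$\delta$-good} if it is continuous and (i) $f'(\alpha(x))-f(x)=\delta$ for all $x\in|T|$; (ii) for every $w\in\mathrm{Im}(\alpha)$, with $x'=\mathrm{LCA}(\alpha^{-1}(w))$, $f(x')-f(u)\le 2\delta$ for all $u\in\alpha^{-1}(w)$; (iii) $\mathrm{depth}(w)\le 2\delta$ for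 every $w\in|T'|\setminus\mathrm{Im}(\alpha)$. The \emph{interleaving distance} is $$d_I((T,f),(T',f'))=\inf\{\delta\mid\text{there is a }\delta\text{-good map }\alpha:|T|\to|T'|\}.$$ A \emph{labeling} of $(T,f)$ with $n$ labels is a map $\pi:\{1,\dots,n\}\to|T|$ whose image contains all leaves (not necessarily injective; labels may lie in the interior of edges, since trees are considered up to subdivision). Its \emph{induced matrix} is $\mathcal{M}(T,f,\pi)_{ij}=f(\mathrm{LCA}(\pi(i),\pi(j)))$, and for labelings $\pi,\pi'$ of $(T,f),(T',f')$ with the same number $n$ of labels the \emph{labeled interleaving distance} is $$d_I^L((T,f,\pi),(T',f',\pi'))=\max_{i,j}\bigl|\mathcal{M}(T,f,\pi)_{ij}-\mathcal{M}(T',f',\pi')_{ij}\bigr|.$$ \textbf{Proposition.} Let $(T,f)$ and $(T',f')$ be merge trees with leaf sets $L$ and $L'$. Then $$d_I((T,f),(T',f'))=\inf_{\pi,\pi'}d_I^L((T,f,\pi),(T',f',\pi')),$$ where the infimum is over all pairs of labelings with a common number $n\le|L|+|L'|$ of labels; both this infimum and the one defining $d_I$ are over nonempty sets of real numbers that are bounded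 below. Moreover: (a) if there is a $\delta$-good map $|T|\to|T'|$, then there are labelings $\pi,\pi'$ with a common number $n\le|L|+|L'|$ of labels such that $d_I^L((T,f,\pi),(T',f',\pi'))\le\delta$; (b) for every $n$ and all labelings $\pi,\pi'$ of $(T,f),(T',f')$ with $n$ labels, with $\delta=d_I^L((T,f,\pi),(T',f',\pi'))$, there is a $\delta$-good map $|T|\to|T'|$. -/

import Mathlib

universe u v

/-- A (finite) merge tree: a finite rooted tree with a height function `f` on its vertices, valued
in `ℝ ∪ {∞}`, such that adjacent vertices have different heights, every non-root vertex has exactly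
one higher neighbour, and the root is a degree one node and the only vertex of height `∞`. -/
structure MergeTree where
  V : Type u
  finite : Finite V
  graph : SimpleGraph V
  isTree : graph.IsTree
  root : V
  f : V → WithTop ℝ
  f_ne_of_adj : ∀ a b, graph.Adj a b → f a ≠ f b
  existsUnique_higher : ∀ a, a ≠ root → ∃! b, graph.Adj a b ∧ f a < f b
  root_degree : (graph.neighborSet root).ncard = 1
  f_eq_top_iff : ∀ a, f a = ⊤ ↔ a = root

namespace MergeTree

/-- The leaves: the non-root vertices of degree one. -/
def leaves (T : MergeTree.{u}) : Set T.V :=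
  {a | a ≠ T.root ∧ (T.graph.neighborSet a).ncard = 1}

/-- `b` is the neighbour of `a` with higher function value. -/
def Up (T : MergeTree.{u}) (a b : T.V) : Prop := T.graph.Adj a b ∧ T.f a < T.f b

/-- `b` is an ancestor of `a` or equal to it: some path from `a` to `b` strictly increases in `f`. -/
def Anc (T : MergeTree.{u}) (a b : T.V) : Prop := Relation.ReflTransGen T.Up a b

/-- The points of finite height of the metric tree `|T|` (that is, all its points except the root).
The edge from a non-root vertex `a` to its higher neighbour `b` is parametrised by height, and
contributes the points `(a, t)` with `f a ≤ t < f b`; in this way every point of the tree, whether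
a vertex or in the interior of an edge, is represented exactly once. -/
@[ext]
structure Point (T : MergeTree.{u}) where
  vertex : T.V
  height : ℝ
  le_height : T.f vertex ≤ (height : WithTop ℝ)
  height_lt : ∀ b, T.Up vertex b → (height : WithTop ℝ) < T.f b

variable {T : MergeTree.{u}}

theorem Up.eq {a b c : T.V} (h : T.Up a b) (h' : T.Up a c) : b = c := by
  have ha : a ≠ T.root := by
    intro ha
    have := (T.f_eq_top_iff a).2 ha
    have h2 := h.2
    rw [this] at h2
    exact not_top_lt h2
  exact (T.existsUnique_higher a ha).unique h h'

theorem Anc.f_le {a b : T.V} (h : T.Anc a b) : T.f a ≤ T.f b := by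
  induction h with
  | refl => exact le_rfl
  | tail _ h ih => exact ih.trans h.2.le

theorem Anc.f_lt {a b : T.V} (h : T.Anc a b) (hne : a ≠ b) : T.f a < T.f b := by
  rcases Relation.ReflTransGen.cases_head h with h | ⟨c, hc, hcb⟩
  · exact absurd h hne
  · exact hc.2.trans_le (Anc.f_le hcb)

theorem Anc.eq_of_f_le {a b : T.V} (h : T.Anc a b) (hf : T.f b ≤ T.f a) : a = b := by
  by_contra hne
  exact absurd (h.f_lt hne) (not_lt.2 hf)

theorem Anc.total {a b c : T.V} (h : T.Anc a b) (h' : T.Anc a c) : T.Anc b c ∨ T.Anc c b :=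
  Relation.ReflTransGen.total_of_right_unique (fun _ _ _ h₁ h₂ => Up.eq h₁ h₂) h h'

theorem anc_root (a : T.V) : T.Anc a T.root := by
  have := T.finite
  have wf : WellFounded (fun a b : T.V => T.f b < T.f a) :=
    @Finite.wellFounded_of_trans_of_irrefl T.V T.finite _
      ⟨fun _ _ _ h₁ h₂ => h₂.trans h₁⟩ ⟨fun _ h => lt_irrefl _ h⟩
  induction a using wf.induction with
  | _ a ih =>
    by_cases ha : a = T.root
    · rw [ha]; exact Relation.ReflTransGen.refl
    · obtain ⟨b, hb, -⟩ := T.existsUnique_higher a ha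
      exact Relation.ReflTransGen.head hb (ih b hb.2)

/-- All non-root vertices have a common non-root ancestor, the neighbour of the root. -/
theorem exists_anc_all (T : MergeTree.{u}) :
    ∃ c, c ≠ T.root ∧ ∀ a, a ≠ T.root → T.Anc a c := by
  obtain ⟨c, hc⟩ := Set.ncard_eq_one.1 T.root_degree
  have hadj : T.graph.Adj T.root c := by
    have : c ∈ T.graph.neighborSet T.root := by rw [hc]; rfl
    exact this
  refine ⟨c, hadj.ne', fun a ha => ?_⟩
  rcases Relation.ReflTransGen.cases_tail (anc_root a) with h | ⟨d, had, hd⟩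
  · exact absurd h.symm ha
  · have : d ∈ T.graph.neighborSet T.root := hd.1.symm
    rw [hc] at this
    rw [Set.mem_singleton_iff.1 this] at had
    exact had

namespace Point

theorem vertex_ne_root (x : T.Point) : x.vertex ≠ T.root := by
  intro h
  have h1 := x.le_height
  rw [(T.f_eq_top_iff _).2 h] at h1
  exact absurd h1 (not_le.2 (WithTop.coe_lt_top _))

theorem height_lt_of_anc (x : T.Point) {a : T.V} (h : T.Anc x.vertex a) (hne : x.vertex ≠ a) :
    (x.height : WithTop ℝ) < T.f a := by
  rcases Relation.ReflTransGen.cases_head h with h | ⟨c, hc, hca⟩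
  · exact absurd h hne
  · exact (x.height_lt c hc).trans_le (Anc.f_le hca)

/-- The ancestor order on the points of the tree: `x ≤ y` if `y` is an ancestor of `x` or equal to
it, that is, if the path from `x` to `y` goes upwards. -/
instance : PartialOrder T.Point where
  le x y := T.Anc x.vertex y.vertex ∧ x.height ≤ y.height
  le_refl _ := ⟨Relation.ReflTransGen.refl, le_rfl⟩
  le_trans _ _ _ h₁ h₂ := ⟨h₁.1.trans h₂.1, h₁.2.trans h₂.2⟩
  le_antisymm _ _ h₁ h₂ :=
    Point.ext (h₁.1.eq_of_f_le h₂.1.f_le) (le_antisymm h₁.2 h₂.2)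

theorem le_def {x y : T.Point} :
    x ≤ y ↔ T.Anc x.vertex y.vertex ∧ x.height ≤ y.height := Iff.rfl

theorem height_mono {x y : T.Point} (h : x ≤ y) : x.height ≤ y.height := h.2

theorem eq_of_le_of_height_le {x y : T.Point} (h : x ≤ y) (hh : y.height ≤ x.height) : x = y := by
  have hv : x.vertex = y.vertex := by
    by_contra hne
    have h1 := (x.height_lt_of_anc h.1 hne).trans_le y.le_height
    exact absurd (WithTop.coe_lt_coe.1 h1) (not_lt.2 hh)
  exact Point.ext hv (le_antisymm h.2 hh)

/-- The ancestors of a point form a chain. -/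
theorem le_total_of_le {x y z : T.Point} (hy : x ≤ y) (hz : x ≤ z) : y ≤ z ∨ z ≤ y := by
  have key : ∀ y z : T.Point, T.Anc y.vertex z.vertex → y ≤ z ∨ z ≤ y := by
    intro y z h
    by_cases hv : y.vertex = z.vertex
    · rcases le_total y.height z.height with hh | hh
      · exact Or.inl ⟨h, hh⟩
      · exact Or.inr ⟨by rw [hv]; exact Relation.ReflTransGen.refl, hh⟩
    · exact Or.inl ⟨h, (WithTop.coe_lt_coe.1
        ((y.height_lt_of_anc h hv).trans_le z.le_height)).le⟩
  rcases hy.1.total hz.1 with h | h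
  · exact key y z h
  · exact (key z y h).symm

theorem exists_isLUB_pair (x y : T.Point) : ∃ z, IsLUB {x, y} z := by
  have := T.finite
  obtain ⟨c, hc, hcanc⟩ := T.exists_anc_all
  obtain ⟨a, ⟨hxa, hya⟩, hmin⟩ := Set.exists_min_image
    {a | T.Anc x.vertex a ∧ T.Anc y.vertex a} T.f (Set.toFinite _)
    ⟨c, hcanc _ x.vertex_ne_root, hcanc _ y.vertex_ne_root⟩
  have hac : T.f a ≠ ⊤ := by
    intro h
    have h1 := hmin c ⟨hcanc _ x.vertex_ne_root, hcanc _ y.vertex_ne_root⟩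
    rw [h, top_le_iff] at h1
    exact hc ((T.f_eq_top_iff c).1 h1)
  obtain ⟨r, hr⟩ := WithTop.ne_top_iff_exists.1 hac
  have hlt : ∀ (p : T.Point) (b : T.V), T.Anc p.vertex a → T.Up a b →
      (p.height : WithTop ℝ) < T.f b := by
    intro p b hpa hb
    by_cases hne : p.vertex = a
    · exact p.height_lt b (by rw [hne]; exact hb)
    · exact (p.height_lt_of_anc hpa hne).trans hb.2
  refine ⟨⟨a, max r (max x.height y.height), ?_, ?_⟩, ?_, ?_⟩
  · rw [← hr]; exact WithTop.coe_le_coe.2 (le_max_left _ _)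
  · intro b hb
    rcases max_choice r (max x.height y.height) with h | h
    · rw [h, hr]; exact hb.2
    · rw [h]
      rcases max_choice x.height y.height with h | h
      · rw [h]; exact hlt x b hxa hb
      · rw [h]; exact hlt y b hya hb
  · rintro p (rfl | rfl)
    · exact ⟨hxa, (le_max_left _ _).trans (le_max_right _ _)⟩
    · exact ⟨hya, (le_max_right _ _).trans (le_max_right _ _)⟩
  · intro z hz
    have hxz : x ≤ z := hz (Or.inl rfl)
    have hyz : y ≤ z := hz (Or.inr rfl)
    have haz : T.f a ≤ T.f z.vertex := hmin _ ⟨hxz.1, hyz.1⟩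
    have hanc : T.Anc a z.vertex := by
      rcases hxa.total hxz.1 with h | h
      · exact h
      · rw [h.eq_of_f_le haz]; exact Relation.ReflTransGen.refl
    refine ⟨hanc, max_le ?_ (max_le hxz.2 hyz.2)⟩
    rw [← hr] at haz
    exact WithTop.coe_le_coe.1 (haz.trans z.le_height)

/-- `x ⊔ y` is the lowest common ancestor of `x` and `y`. -/
noncomputable instance : SemilatticeSup T.Point where
  sup x y := (exists_isLUB_pair x y).choose
  le_sup_left x y := (exists_isLUB_pair x y).choose_spec.1 (Or.inl rfl)
  le_sup_right x y := (exists_isLUB_pair x y).choose_spec.1 (Or.inr rfl)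
  sup_le x y z hx hy := (exists_isLUB_pair x y).choose_spec.2 (by
    rintro p (rfl | rfl)
    · exact hx
    · exact hy)

/-- The length of the unique path from `x` to `y`, which goes up from `x` to the lowest common
ancestor of `x` and `y` and then down to `y`; an edge between heights `s` and `t` has length
`|s - t|`. -/
noncomputable def pathLength (x y : T.Point) : ℝ :=
  ((x ⊔ y).height - x.height) + ((x ⊔ y).height - y.height)

/-- The metric tree: the distance of two points is the length of the path between them. -/
noncomputable instance : MetricSpace T.Point where
  dist := pathLength
  dist_self x := by simp [pathLength]
  dist_comm x y := by simp only [pathLength, sup_comm x y]; ring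
  dist_triangle x y z := by
    simp only [pathLength]
    have h1 := height_mono (le_sup_left : x ≤ x ⊔ y)
    have h2 := height_mono (le_sup_right : y ≤ x ⊔ y)
    have h3 := height_mono (le_sup_left : y ≤ y ⊔ z)
    have h4 := height_mono (le_sup_right : z ≤ y ⊔ z)
    rcases le_total_of_le (le_sup_right : y ≤ x ⊔ y) (le_sup_left : y ≤ y ⊔ z) with h | h
    · have := height_mono (sup_le (le_sup_left.trans h) le_sup_right : x ⊔ z ≤ y ⊔ z)
      linarith
    · have := height_mono (sup_le le_sup_left (le_sup_right.trans h) : x ⊔ z ≤ x ⊔ y)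
      linarith
  eq_of_dist_eq_zero := by
    intro x y h
    simp only [pathLength] at h
    have h1 := height_mono (le_sup_left : x ≤ x ⊔ y)
    have h2 := height_mono (le_sup_right : y ≤ x ⊔ y)
    have hx := eq_of_le_of_height_le (le_sup_left : x ≤ x ⊔ y) (by linarith)
    have hy := eq_of_le_of_height_le (le_sup_right : y ≤ x ⊔ y) (by linarith)
    exact hx.trans hy.symm

/-- The largest height difference between `w` and a point of the subtree rooted at `w`. -/
noncomputable def depth (w : T.Point) : ℝ :=
  sSup {d | ∃ u : T.Point, u ≤ w ∧ d = w.height - u.height}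

/-- The supremum that defines the depth is over a bounded set. -/
theorem depth_bddAbove (w : T.Point) :
    BddAbove {d | ∃ u : T.Point, u ≤ w ∧ d = w.height - u.height} := by
  have := T.finite
  obtain ⟨m, hm⟩ := (Set.toFinite (Set.range fun a : T.V => (T.f a).untopD 0)).bddBelow
  refine ⟨w.height - m, ?_⟩
  rintro _ ⟨p, -, rfl⟩
  have h1 := hm ⟨p.vertex, rfl⟩
  have h2 := p.le_height
  obtain ⟨r, hr⟩ := WithTop.ne_top_iff_exists.1
    (fun h => p.vertex_ne_root ((T.f_eq_top_iff _).1 h))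
  simp only [← hr, WithTop.untopD_coe] at h1
  rw [← hr] at h2
  have := WithTop.coe_le_coe.1 h2
  linarith

end Point

/-- A non-root vertex as a point of the metric tree. -/
def ofVertex (T : MergeTree.{u}) (a : T.V) (ha : a ≠ T.root) : T.Point where
  vertex := a
  height := (T.f a).untop (fun h => ha ((T.f_eq_top_iff a).1 h))
  le_height := by rw [WithTop.coe_untop]
  height_lt b hb := by rw [WithTop.coe_untop]; exact hb.2

/-- `δ`-good maps between merge trees. The lowest common ancestor of a set of points is its least
upper bound in the ancestor order. -/
structure IsGood (T : MergeTree.{u}) (T' : MergeTree.{v}) (δ : ℝ) (α : T.Point → T'.Point) :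
    Prop where
  continuous : Continuous α
  height_sub : ∀ x, (α x).height - x.height = δ
  lca_le : ∀ w ∈ Set.range α, ∃ x', IsLUB (α ⁻¹' {w}) x' ∧
    ∀ p ∈ α ⁻¹' {w}, x'.height - p.height ≤ 2 * δ
  depth_le : ∀ w ∉ Set.range α, w.depth ≤ 2 * δ

/-- The set of all `δ` for which there is a `δ`-good map. -/
def goodSet (T : MergeTree.{u}) (T' : MergeTree.{v}) : Set ℝ :=
  {δ | ∃ α : T.Point → T'.Point, IsGood T T' δ α}

/-- The interleaving distance. -/
noncomputable def interleavingDist (T : MergeTree.{u}) (T' : MergeTree.{v}) : ℝ :=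
  sInf (goodSet T T')

/-- A labeling with `n` labels whose image contains all leaves. Merge trees are considered up to
subdivision of edges, so labels may be put on arbitrary points of the metric tree. -/
structure Labeling (T : MergeTree.{u}) (n : ℕ) where
  toFun : Fin n → T.Point
  surj_leaves : ∀ a (ha : a ∈ T.leaves), T.ofVertex a ha.1 ∈ Set.range toFun

/-- The induced matrix of a labeled merge tree: the heights of the lowest common ancestors. -/
noncomputable def inducedMatrix {n : ℕ} (π : Labeling T n) : Matrix (Fin n) (Fin n) ℝ :=
  Matrix.of fun i j => (π.toFun i ⊔ π.toFun j).height

section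

attribute [local instance] Matrix.normedAddCommGroup

/-- The labeled interleaving distance: the largest absolute value of an entry of the difference of
the induced matrices. -/
noncomputable def labeledInterleavingDist {T : MergeTree.{u}} {T' : MergeTree.{v}} {n : ℕ}
    (π : Labeling T n) (π' : Labeling T' n) : ℝ :=
  ‖inducedMatrix π - inducedMatrix π'‖

end

/-- All labeled interleaving distances for pairs of labelings with a common number of labels, which
is at most the total number of leaves. -/
def labeledDistSet (T : MergeTree.{u}) (T' : MergeTree.{v}) : Set ℝ :=
  {d | ∃ n ≤ T.leaves.ncard + T'.leaves.ncard, ∃ (π : Labeling T n) (π' : Labeling T' n),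
    d = labeledInterleavingDist π π'}

end MergeTree

/-!
The ancestors of a point form a chain ordered by height, and every point that is close to `x` and at
least as high is an ancestor of `x`. Hence a map that raises heights by a constant is continuous
exactly when it is monotone, and being `δ`-good becomes a purely order-theoretic condition.

Given a good map `α`, put a label on every leaf `a` of `T`, matched with `α a`, and a label on every
leaf of `T'`, matched with a preimage of its lowest ancestor in the image of `α`. If the lowest
common ancestor of two labels of `T'` misses the image, then both labels have the same lowest
ancestor in the image, so both are matched with the same point of `T`.

Conversely, given labelings, send `x` to the point at height `f x + δ` above the partner of any
label below `x`. The bound on the matrices says that the choice of the label does not matter.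
-/

namespace MergeTree

open scoped Topology

namespace Point

variable {T : MergeTree.{u}} {T' : MergeTree.{v}}

instance : Nonempty T.Point :=
  let ⟨c, hc, _⟩ := T.exists_anc_all
  ⟨T.ofVertex c hc⟩

theorem le_of_le_of_height_le {x y z : T.Point} (hy : x ≤ y) (hz : x ≤ z)
    (h : y.height ≤ z.height) : y ≤ z := by
  rcases le_total_of_le hy hz with hyz | hzy
  · exact hyz
  · exact (eq_of_le_of_height_le hzy h).ge

theorem eq_of_le_of_height_eq {x y z : T.Point} (hy : x ≤ y) (hz : x ≤ z)
    (h : y.height = z.height) : y = z :=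
  eq_of_le_of_height_le (le_of_le_of_height_le hy hz h.le) h.ge

theorem height_sup_le_max {a b x y : T.Point} (ha : a ≤ x) (hb : b ≤ y) :
    (x ⊔ y).height ≤ max (a ⊔ b).height (max x.height y.height) := by
  have of_comparable (h : x ≤ y ∨ y ≤ x) :
      (x ⊔ y).height ≤ max (a ⊔ b).height (max x.height y.height) := by
    rcases h with h | h
    · rw [sup_eq_right.2 h]
      exact le_max_of_le_right (le_max_right _ _)
    · rw [sup_eq_left.2 h]
      exact le_max_of_le_right (le_max_left _ _)
  rcases le_total_of_le ha (le_sup_left : a ≤ a ⊔ b) with hx | hx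
  · rcases le_total_of_le hb (le_sup_right : b ≤ a ⊔ b) with hy | hy
    · exact le_max_of_le_left (height_mono (sup_le hx hy))
    · exact of_comparable (.inl (hx.trans hy))
  · exact of_comparable (le_total_of_le (le_sup_right.trans hx) hb)

theorem exists_forall_sup_le_sup {ι : Type*} [Finite ι] [Nonempty ι] (y : T.Point)
    (q : ι → T.Point) : ∃ i, ∀ j, y ⊔ q i ≤ y ⊔ q j := by
  obtain ⟨i, hi⟩ := Finite.exists_min fun i => (y ⊔ q i).height
  exact ⟨i, fun j => le_of_le_of_height_le le_sup_left le_sup_left (hi j)⟩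

theorem finite_setOf_height_eq (t : ℝ) : {x : T.Point | x.height = t}.Finite := by
  have := T.finite
  exact Set.Finite.of_injOn (Set.mapsTo_univ Point.vertex _)
    (fun _ hx _ hy h => Point.ext h (Eq.trans hx (Eq.symm hy))) Set.finite_univ

theorem finite_preimage_singleton {α : T.Point → T'.Point} {δ : ℝ}
    (hheight : ∀ x, (α x).height = x.height + δ) (w : T'.Point) : (α ⁻¹' {w}).Finite :=
  (finite_setOf_height_eq (w.height - δ)).subset fun x hx => by
    rw [Set.mem_ofPred_eq, ← Set.mem_singleton_iff.1 hx, hheight, add_sub_cancel_right]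

theorem exists_ge_height_eq (x : T.Point) {t : ℝ} (ht : x.height ≤ t) :
    ∃ y : T.Point, x ≤ y ∧ y.height = t := by
  have := T.finite
  obtain ⟨a, ⟨hxa, hat⟩, hmax⟩ := Set.exists_max_image
    {a | T.Anc x.vertex a ∧ T.f a ≤ (t : WithTop ℝ)} T.f (Set.toFinite _)
    ⟨x.vertex, Relation.ReflTransGen.refl, x.le_height.trans (WithTop.coe_le_coe.2 ht)⟩
  refine ⟨⟨a, t, hat, fun b hb => ?_⟩, ⟨hxa, ht⟩, rfl⟩
  by_contra! hbt
  exact (hmax b ⟨hxa.tail hb, hbt⟩).not_gt hb.2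

/-- The ancestor of `x` at height `t`. It is `x` itself if `t` is below the height of `x`, so that
`x.ancestorAt` is defined and continuous on all of `ℝ`. -/
noncomputable def ancestorAt (x : T.Point) (t : ℝ) : T.Point :=
  (x.exists_ge_height_eq (le_max_left x.height t)).choose

theorem le_ancestorAt (x : T.Point) (t : ℝ) : x ≤ x.ancestorAt t :=
  (x.exists_ge_height_eq (le_max_left x.height t)).choose_spec.1

theorem height_ancestorAt (x : T.Point) (t : ℝ) : (x.ancestorAt t).height = max x.height t :=
  (x.exists_ge_height_eq (le_max_left x.height t)).choose_spec.2

theorem height_ancestorAt_of_le {x : T.Point} {t : ℝ} (h : x.height ≤ t) :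
    (x.ancestorAt t).height = t := by
  rw [height_ancestorAt, max_eq_right h]

theorem ancestorAt_height_of_le {x y : T.Point} (h : x ≤ y) : x.ancestorAt y.height = y :=
  eq_of_le_of_height_eq (x.le_ancestorAt _) h (height_ancestorAt_of_le h.2)

theorem monotone_ancestorAt (x : T.Point) : Monotone x.ancestorAt := fun s t hst =>
  le_of_le_of_height_le (x.le_ancestorAt s) (x.le_ancestorAt t) <| by
    simpa only [height_ancestorAt] using max_le_max_left _ hst

theorem dist_def (x y : T.Point) :
    dist x y = ((x ⊔ y).height - x.height) + ((x ⊔ y).height - y.height) := rfl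

theorem dist_of_le {x y : T.Point} (h : x ≤ y) : dist x y = y.height - x.height := by
  rw [dist_def, sup_eq_right.2 h]
  ring

theorem le_iff_dist_eq {x y : T.Point} : x ≤ y ↔ dist x y = y.height - x.height := by
  refine ⟨dist_of_le, fun h => ?_⟩
  rw [dist_def] at h
  have hy : y = x ⊔ y := eq_of_le_of_height_le le_sup_right (by linarith)
  exact sup_eq_right.1 hy.symm

theorem lipschitzWith_height : LipschitzWith 1 (Point.height : T.Point → ℝ) := by
  refine LipschitzWith.of_dist_le_mul fun x y => ?_
  have hx : x.height ≤ (x ⊔ y).height := height_mono le_sup_left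
  have hy : y.height ≤ (x ⊔ y).height := height_mono le_sup_right
  rw [NNReal.coe_one, one_mul, dist_def, Real.dist_eq, abs_le]
  constructor <;> linarith

@[fun_prop]
theorem continuous_height : Continuous (Point.height : T.Point → ℝ) :=
  lipschitzWith_height.continuous

instance : OrderClosedTopology T.Point where
  isClosed_le' := by
    simp only [le_iff_dist_eq]
    exact isClosed_eq (by fun_prop) (by fun_prop)

theorem continuous_height_sup_right (x : T.Point) : Continuous fun y => (x ⊔ y).height := by
  have height_sup_eq (y : T.Point) : (x ⊔ y).height = (dist x y + x.height + y.height) / 2 := by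
    rw [dist_def]
    ring
  simp only [height_sup_eq]
  fun_prop

theorem continuous_ancestorAt (x : T.Point) : Continuous x.ancestorAt := by
  refine (LipschitzWith.of_dist_le_mul (K := 1) fun s t => ?_).continuous
  wlog hst : s ≤ t generalizing s t
  · rw [dist_comm, dist_comm s]
    exact this t s (le_of_not_ge hst)
  rw [dist_of_le (x.monotone_ancestorAt hst), height_ancestorAt, height_ancestorAt, NNReal.coe_one,
    one_mul, dist_comm, Real.dist_eq, max_comm _ t, max_comm _ s]
  exact (le_abs_self _).trans (abs_max_sub_max_le_abs t s x.height)

theorem vertex_eq_of_le_of_height_lt {x z : T.Point} (hxz : x ≤ z) {b : T.V}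
    (hb : T.Up x.vertex b) (hzb : (z.height : WithTop ℝ) < T.f b) : x.vertex = z.vertex := by
  rcases Relation.ReflTransGen.cases_head hxz.1 with h | ⟨c, hc, hcz⟩
  · exact h
  · rw [hc.eq hb] at hcz
    exact absurd ((Anc.f_le hcz).trans z.le_height) hzb.not_ge

theorem eventually_le_of_height_le (x : T.Point) :
    ∀ᶠ y in 𝓝 x, x.height ≤ y.height → x ≤ y := by
  obtain ⟨b, hb, -⟩ := T.existsUnique_higher _ x.vertex_ne_root
  obtain ⟨r, hxr, hrb⟩ := WithTop.lt_iff_exists_coe_btwn.1 (x.height_lt b hb)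
  have sup_below_b : ∀ᶠ y in 𝓝 x, (x ⊔ y).height < r :=
    (continuous_height_sup_right x).continuousAt.eventually_lt_const
      (by simpa only [sup_idem] using WithTop.coe_lt_coe.1 hxr)
  filter_upwards [sup_below_b] with y hy hxy
  have hv : x.vertex = (x ⊔ y).vertex :=
    vertex_eq_of_le_of_height_lt le_sup_left hb ((WithTop.coe_lt_coe.2 hy).trans hrb)
  have hanc : T.Anc y.vertex x.vertex := by
    rw [hv]
    exact (le_sup_right : y ≤ x ⊔ y).1
  have hyv : y.vertex = x.vertex := by
    by_contra hne
    exact ((y.height_lt_of_anc hanc hne).trans_le x.le_height).not_ge (WithTop.coe_le_coe.2 hxy)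
  exact ⟨by rw [hyv]; exact Relation.ReflTransGen.refl, hxy⟩

theorem monotone_of_continuous_of_monotone_height {R : Type*} [ConditionallyCompleteLinearOrder R]
    [TopologicalSpace R] [OrderTopology R] [DenselyOrdered R] {γ : R → T.Point}
    (hγ : Continuous γ) (hheight : Monotone fun t => (γ t).height) : Monotone γ := by
  intro a b hab
  suffices h : Set.Icc a b ⊆ {t | γ a ≤ γ t} from h (Set.right_mem_Icc.2 hab)
  refine IsClosed.Icc_subset_of_forall_mem_nhdsWithin
    ((isClosed_Ici.preimage hγ).inter isClosed_Icc) (le_refl (γ a)) ?_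
  rintro t ⟨hat, -⟩
  have hright : ∀ᶠ s in 𝓝[>] t, (γ t).height ≤ (γ s).height → γ t ≤ γ s :=
    nhdsWithin_le_nhds (hγ.continuousAt.eventually (γ t).eventually_le_of_height_le)
  filter_upwards [hright, self_mem_nhdsWithin] with s hs hts
  exact le_trans hat (hs (hheight (le_of_lt hts)))

theorem lipschitzWith_one_of_monotone {α : T.Point → T'.Point} {δ : ℝ} (hα : Monotone α)
    (hheight : ∀ x, (α x).height = x.height + δ) : LipschitzWith 1 α := by
  refine LipschitzWith.of_dist_le_mul fun x y => ?_
  have hsup : (α x ⊔ α y).height ≤ (α (x ⊔ y)).height :=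
    height_mono (sup_le (hα le_sup_left) (hα le_sup_right))
  rw [hheight] at hsup
  rw [NNReal.coe_one, one_mul, dist_def, dist_def, hheight, hheight]
  linarith

theorem continuous_iff_monotone_of_height_eq_add {α : T.Point → T'.Point} {δ : ℝ}
    (hheight : ∀ x, (α x).height = x.height + δ) : Continuous α ↔ Monotone α := by
  refine ⟨fun hα x y hxy => ?_, fun hα => (lipschitzWith_one_of_monotone hα hheight).continuous⟩
  have hpath : Monotone fun t => α (x.ancestorAt t) := by
    refine monotone_of_continuous_of_monotone_height (hα.comp x.continuous_ancestorAt)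
      fun s t hst => ?_
    simpa only [hheight, add_le_add_iff_right] using height_mono (x.monotone_ancestorAt hst)
  simpa only [ancestorAt_height_of_le le_rfl, ancestorAt_height_of_le hxy] using
    hpath (height_mono hxy)

theorem depth_le_iff {w : T.Point} {r : ℝ} : w.depth ≤ r ↔ ∀ u ≤ w, w.height ≤ u.height + r := by
  rw [depth, csSup_le_iff w.depth_bddAbove ⟨_, w, le_rfl, rfl⟩]
  constructor
  · intro h u hu
    exact sub_le_iff_le_add'.1 (h _ ⟨u, hu, rfl⟩)
  · rintro h _ ⟨u, hu, rfl⟩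
    exact sub_le_iff_le_add'.2 (h u hu)

theorem exists_isLUB_height_sub_le_iff {s : Set T.Point} (hs : s.Finite) (hne : s.Nonempty)
    {r : ℝ} : (∃ z, IsLUB s z ∧ ∀ p ∈ s, z.height - p.height ≤ r) ↔
      ∀ p ∈ s, ∀ q ∈ s, (p ⊔ q).height ≤ p.height + r := by
  constructor
  · rintro ⟨z, hz, hzr⟩ p hp q hq
    linarith [hzr p hp, height_mono (sup_le (hz.1 hp) (hz.1 hq))]
  · intro h
    have hz := Finset.isLUB_sup' (hs.toFinset_nonempty.2 hne)
    rw [hs.coe_toFinset] at hz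
    refine ⟨_, hz, fun p hp => ?_⟩
    have hpr : (p.ancestorAt (p.height + r)).height = p.height + r :=
      height_ancestorAt_of_le (by simpa only [sup_idem] using h p hp p hp)
    have hub : p.ancestorAt (p.height + r) ∈ upperBounds s := fun q hq =>
      le_sup_right.trans
        (le_of_le_of_height_le le_sup_left (p.le_ancestorAt _) ((h p hp q hq).trans_eq hpr.symm))
    linarith [height_mono (hz.2 hub)]

end Point

open Point

variable {T : MergeTree.{u}} {T' : MergeTree.{v}}

/-- The leaf `a` as a point of the metric tree. -/
def leafPoint (T : MergeTree.{u}) (a : T.leaves) : T.Point := T.ofVertex a a.2.1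

theorem mem_leaves_of_forall_f_le {a b : T.V} (hb : T.Up a b)
    (hmin : ∀ c, T.Up c a → T.f a ≤ T.f c) : a ∈ T.leaves := by
  have ha : a ≠ T.root := by
    rintro rfl
    exact not_top_lt ((T.f_eq_top_iff _).2 rfl ▸ hb.2)
  refine ⟨ha, Set.ncard_eq_one.2 ⟨b, Set.eq_singleton_iff_unique_mem.2 ⟨hb.1, fun c hc => ?_⟩⟩⟩
  rcases lt_or_gt_of_ne (T.f_ne_of_adj _ _ hc) with hac | hca
  · exact Up.eq ⟨hc, hac⟩ hb
  · exact absurd (hmin c ⟨hc.symm, hca⟩) hca.not_ge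

theorem exists_leafPoint_le (x : T.Point) : ∃ a, T.leafPoint a ≤ x := by
  have := T.finite
  obtain ⟨a, hax, hmin⟩ := Set.exists_min_image {a | T.Anc a x.vertex} T.f (Set.toFinite _)
    ⟨x.vertex, Relation.ReflTransGen.refl⟩
  have hle : T.f a ≤ (x.height : WithTop ℝ) := (Anc.f_le hax).trans x.le_height
  have ha : a ≠ T.root := by
    rintro rfl
    exact (WithTop.coe_lt_top x.height).not_ge ((T.f_eq_top_iff _).2 rfl ▸ hle)
  obtain ⟨b, hb, -⟩ := T.existsUnique_higher a ha
  have hleaf : a ∈ T.leaves :=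
    mem_leaves_of_forall_f_le hb fun c hc => hmin c (Relation.ReflTransGen.head hc hax)
  exact ⟨⟨a, hleaf⟩, hax, (WithTop.untop_le_iff _).2 hle⟩

instance : Finite T.leaves :=
  have := T.finite
  inferInstance

instance : Nonempty T.leaves :=
  let ⟨a, _⟩ := exists_leafPoint_le (Classical.arbitrary T.Point)
  ⟨a⟩

namespace IsGood

variable {δ : ℝ} {α : T.Point → T'.Point}

theorem height_apply (h : IsGood T T' δ α) (x : T.Point) : (α x).height = x.height + δ := by
  linarith [h.height_sub x]

theorem monotone (h : IsGood T T' δ α) : Monotone α :=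
  (continuous_iff_monotone_of_height_eq_add h.height_apply).1 h.continuous

theorem height_sup_le_of_apply_eq (h : IsGood T T' δ α) {x y : T.Point} (hxy : α x = α y) :
    (x ⊔ y).height ≤ x.height + 2 * δ :=
  (exists_isLUB_height_sub_le_iff (finite_preimage_singleton h.height_apply (α y)) ⟨y, rfl⟩).1
    (h.lca_le _ ⟨y, rfl⟩) x hxy y rfl

theorem height_le_of_notMem_range (h : IsGood T T' δ α) {u w : T'.Point} (hw : w ∉ Set.range α)
    (hu : u ≤ w) : w.height ≤ u.height + 2 * δ :=
  depth_le_iff.1 (h.depth_le w hw) u hu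

theorem of_monotone (hheight : ∀ x, (α x).height = x.height + δ) (hmono : Monotone α)
    (hfiber : ∀ x y, α x = α y → (x ⊔ y).height ≤ x.height + 2 * δ)
    (hdepth : ∀ w ∉ Set.range α, ∀ u ≤ w, w.height ≤ u.height + 2 * δ) : IsGood T T' δ α where
  continuous := (continuous_iff_monotone_of_height_eq_add hheight).2 hmono
  height_sub x := by rw [hheight, add_sub_cancel_left]
  lca_le w hw := (exists_isLUB_height_sub_le_iff (finite_preimage_singleton hheight w) hw).2
    fun x hx y hy => hfiber x y (Eq.trans hx (Eq.symm hy))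
  depth_le w hw := depth_le_iff.2 (hdepth w hw)

theorem nonneg (h : IsGood T T' δ α) : 0 ≤ δ := by
  have := h.height_sup_le_of_apply_eq (rfl : α (Classical.arbitrary _) = _)
  rw [sup_idem] at this
  linarith

theorem apply_ancestorAt (h : IsGood T T' δ α) {x : T.Point} {w : T'.Point} (hw : α x ≤ w) :
    α (x.ancestorAt (w.height - δ)) = w := by
  have hx : x.height ≤ w.height - δ := by linarith [height_mono hw, h.height_apply x]
  refine eq_of_le_of_height_eq (h.monotone (x.le_ancestorAt _)) hw ?_
  rw [h.height_apply, height_ancestorAt_of_le hx, sub_add_cancel]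

theorem isUpperSet_range (h : IsGood T T' δ α) : IsUpperSet (Set.range α) := by
  rintro _ w hw ⟨x, rfl⟩
  exact ⟨_, h.apply_ancestorAt hw⟩

theorem height_sup_le_of_apply_le (h : IsGood T T' δ α) {x y : T.Point} {w : T'.Point}
    (hx : α x ≤ w) (hy : α y ≤ w) : (x ⊔ y).height ≤ w.height + δ := by
  have hfiber := h.height_sup_le_of_apply_eq
    ((h.apply_ancestorAt hx).trans (h.apply_ancestorAt hy).symm)
  have hwx : x.height ≤ w.height - δ := by linarith [height_mono hx, h.height_apply x]
  rw [height_ancestorAt_of_le hwx] at hfiber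
  linarith [height_mono (sup_le_sup (x.le_ancestorAt (w.height - δ))
    (y.le_ancestorAt (w.height - δ)))]

theorem height_sup_le_add (h : IsGood T T' δ α) {x y : T.Point} {x' y' : T'.Point}
    (hx : x' ≤ α x) (hy : y' ≤ α y) : (x' ⊔ y').height ≤ (x ⊔ y).height + δ := by
  rw [← h.height_apply]
  exact height_mono
    (sup_le (hx.trans (h.monotone le_sup_left)) (hy.trans (h.monotone le_sup_right)))

theorem exists_isLeast_Ici_inter_range (h : IsGood T T' δ α) (y : T'.Point) :
    ∃ x, IsLeast (Set.Ici y ∩ Set.range α) (α x) := by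
  obtain ⟨a, ha⟩ := exists_forall_sup_le_sup y fun a => α (T.leafPoint a)
  obtain ⟨x, hx⟩ := h.isUpperSet_range (le_sup_right : _ ≤ y ⊔ α (T.leafPoint a)) ⟨_, rfl⟩
  refine ⟨x, hx ▸ ⟨⟨Set.mem_Ici.2 le_sup_left, x, hx⟩, ?_⟩⟩
  rintro _ ⟨hyv, v, rfl⟩
  obtain ⟨b, hb⟩ := exists_leafPoint_le v
  exact (ha b).trans (sup_le hyv (h.monotone hb))

theorem height_le_of_isLeast (h : IsGood T T' δ α) {y w : T'.Point}
    (hw : IsLeast (Set.Ici y ∩ Set.range α) w) : w.height ≤ y.height + 2 * δ := by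
  refine le_of_forall_lt_imp_le_of_dense fun t htw => ?_
  rcases le_total t y.height with hty | hyt
  · linarith [h.nonneg]
  have hheight : (y.ancestorAt t).height = t := height_ancestorAt_of_le hyt
  have hnotMem : y.ancestorAt t ∉ Set.range α := fun hmem =>
    (height_mono (hw.2 ⟨y.le_ancestorAt t, hmem⟩)).not_gt (hheight.trans_lt htw)
  exact hheight.symm.trans_le (h.height_le_of_notMem_range hnotMem (y.le_ancestorAt t))

theorem apply_eq_apply_of_isLeast (h : IsGood T T' δ α) {x y : T.Point} {x' y' : T'.Point}
    (hx : IsLeast (Set.Ici x' ∩ Set.range α) (α x)) (hy : IsLeast (Set.Ici y' ∩ Set.range α) (α y))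
    (hsup : x' ⊔ y' ∉ Set.range α) : α x = α y := by
  have sup_le_apply {z : T.Point} {z' : T'.Point} (hz : IsLeast (Set.Ici z' ∩ Set.range α) (α z))
      (hz' : z' ≤ x' ⊔ y') : x' ⊔ y' ≤ α z :=
    (le_total_of_le hz' hz.1.1).resolve_right fun hle =>
      hsup (h.isUpperSet_range hle ⟨z, rfl⟩)
  exact le_antisymm
    (hx.2 ⟨le_sup_left.trans (sup_le_apply hy le_sup_right), y, rfl⟩)
    (hy.2 ⟨le_sup_right.trans (sup_le_apply hx le_sup_left), x, rfl⟩)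

/-- A preimage under the good map `α` of the lowest ancestor of `y` in the image of `α`. Points with
the same lowest ancestor in the image get the same preimage. -/
noncomputable def lowestPreimage (h : IsGood T T' δ α) (y : T'.Point) : T.Point :=
  Function.invFun α (α (h.exists_isLeast_Ici_inter_range y).choose)

theorem apply_lowestPreimage (h : IsGood T T' δ α) (y : T'.Point) :
    α (h.lowestPreimage y) = α (h.exists_isLeast_Ici_inter_range y).choose :=
  Function.invFun_eq ⟨_, rfl⟩

theorem isLeast_apply_lowestPreimage (h : IsGood T T' δ α) (y : T'.Point) :
    IsLeast (Set.Ici y ∩ Set.range α) (α (h.lowestPreimage y)) :=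
  h.apply_lowestPreimage y ▸ (h.exists_isLeast_Ici_inter_range y).choose_spec

theorem lowestPreimage_eq_of_apply_eq (h : IsGood T T' δ α) {y z : T'.Point}
    (hyz : α (h.lowestPreimage y) = α (h.lowestPreimage z)) :
    h.lowestPreimage y = h.lowestPreimage z :=
  congrArg (Function.invFun α)
    ((h.apply_lowestPreimage y).symm.trans (hyz.trans (h.apply_lowestPreimage z)))

/-- The pairs of points that carry the same label when a good map `α` is turned into a pair of
labelings: a point of `T` and its image, or a point of `T'` and its lowest preimage. -/
def IsMatched (h : IsGood T T' δ α) (x : T.Point) (x' : T'.Point) : Prop :=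
  x' = α x ∨ x = h.lowestPreimage x'

theorem IsMatched.isLeast {h : IsGood T T' δ α} {x : T.Point} {x' : T'.Point}
    (hx : h.IsMatched x x') : IsLeast (Set.Ici x' ∩ Set.range α) (α x) := by
  rcases hx with rfl | rfl
  · exact ⟨⟨Set.self_mem_Ici, x, rfl⟩, fun _ hv => hv.1⟩
  · exact h.isLeast_apply_lowestPreimage x'

theorem IsMatched.eq_of_sup_notMem_range {h : IsGood T T' δ α} {x y : T.Point} {x' y' : T'.Point}
    (hx : h.IsMatched x x') (hy : h.IsMatched y y') (hsup : x' ⊔ y' ∉ Set.range α) : x = y := by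
  have hxy : α x = α y := h.apply_eq_apply_of_isLeast hx.isLeast hy.isLeast hsup
  rcases hx with rfl | rfl
  · exact absurd (h.isUpperSet_range le_sup_left ⟨x, rfl⟩) hsup
  rcases hy with rfl | rfl
  · exact absurd (h.isUpperSet_range le_sup_right ⟨y, rfl⟩) hsup
  exact h.lowestPreimage_eq_of_apply_eq hxy

theorem IsMatched.height_sup_le_add {h : IsGood T T' δ α} {x y : T.Point} {x' y' : T'.Point}
    (hx : h.IsMatched x x') (hy : h.IsMatched y y') :
    (x ⊔ y).height ≤ (x' ⊔ y').height + δ := by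
  by_cases hsup : x' ⊔ y' ∈ Set.range α
  · exact h.height_sup_le_of_apply_le (hx.isLeast.2 ⟨Set.mem_Ici.2 le_sup_left, hsup⟩)
      (hy.isLeast.2 ⟨Set.mem_Ici.2 le_sup_right, hsup⟩)
  · rw [← hx.eq_of_sup_notMem_range hy hsup, sup_idem]
    have hsup' : x'.height ≤ (x' ⊔ y').height := height_mono le_sup_left
    linarith [h.height_le_of_isLeast hx.isLeast, h.height_apply x]

theorem IsMatched.abs_height_sup_sub_le {h : IsGood T T' δ α} {x y : T.Point} {x' y' : T'.Point}
    (hx : h.IsMatched x x') (hy : h.IsMatched y y') :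
    |(x ⊔ y).height - (x' ⊔ y').height| ≤ δ :=
  abs_sub_le_iff.2
    ⟨sub_le_iff_le_add'.2 (hx.height_sup_le_add hy),
      sub_le_iff_le_add'.2 (h.height_sup_le_add hx.isLeast.1.1 hy.isLeast.1.1)⟩

end IsGood

section

attribute [local instance] Matrix.normedAddCommGroup

theorem labeledInterleavingDist_nonneg {n : ℕ} (π : Labeling T n) (π' : Labeling T' n) :
    0 ≤ labeledInterleavingDist π π' :=
  norm_nonneg _

theorem labeledInterleavingDist_le_iff {n : ℕ} {π : Labeling T n} {π' : Labeling T' n} {r : ℝ}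
    (hr : 0 ≤ r) : labeledInterleavingDist π π' ≤ r ↔
      ∀ i j, |(π.toFun i ⊔ π.toFun j).height - (π'.toFun i ⊔ π'.toFun j).height| ≤ r :=
  Matrix.norm_le_iff hr

end

/-- An enumeration of the leaves of two trees, which serves as the common set of labels. -/
noncomputable def leafSumEquiv (T : MergeTree.{u}) (T' : MergeTree.{v}) :
    T.leaves ⊕ T'.leaves ≃ Fin (T.leaves.ncard + T'.leaves.ncard) :=
  (Equiv.sumCongr (Finite.equivFin T.leaves) (Finite.equivFin T'.leaves)).trans finSumFinEquiv

namespace Labeling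

/-- The labeling of `T` by the leaves of `T` and `T'` that puts every leaf of `T` on itself and
every leaf `b` of `T'` on `g b`. -/
noncomputable def extendLeft (g : T'.leaves → T.Point) :
    Labeling T (T.leaves.ncard + T'.leaves.ncard) where
  toFun := Sum.elim T.leafPoint g ∘ (leafSumEquiv T T').symm
  surj_leaves a ha := ⟨leafSumEquiv T T' (.inl ⟨a, ha⟩), by simp [leafPoint]⟩

/-- The labeling of `T'` by the leaves of `T` and `T'` that puts every leaf of `T'` on itself and
every leaf `a` of `T` on `g a`. -/
noncomputable def extendRight (g : T.leaves → T'.Point) :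
    Labeling T' (T.leaves.ncard + T'.leaves.ncard) where
  toFun := Sum.elim g T'.leafPoint ∘ (leafSumEquiv T T').symm
  surj_leaves b hb := ⟨leafSumEquiv T T' (.inr ⟨b, hb⟩), by simp [leafPoint]⟩

theorem exists_toFun_le {n : ℕ} (π : Labeling T n) (x : T.Point) : ∃ i, π.toFun i ≤ x := by
  obtain ⟨a, hax⟩ := exists_leafPoint_le x
  obtain ⟨i, hi⟩ := π.surj_leaves a a.2
  exact ⟨i, hi.trans_le hax⟩

end Labeling

theorem IsGood.exists_labeledInterleavingDist_le {δ : ℝ} {α : T.Point → T'.Point}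
    (h : IsGood T T' δ α) :
    ∃ n ≤ T.leaves.ncard + T'.leaves.ncard, ∃ (π : Labeling T n) (π' : Labeling T' n),
      labeledInterleavingDist π π' ≤ δ := by
  let π := Labeling.extendLeft fun b => h.lowestPreimage (T'.leafPoint b)
  let π' := Labeling.extendRight fun a => α (T.leafPoint a)
  have hmatched (i) : h.IsMatched (π.toFun i) (π'.toFun i) := by
    rcases hi : (leafSumEquiv T T').symm i with a | b
    · exact .inl (by simp [π, π', Labeling.extendLeft, Labeling.extendRight, hi])
    · exact .inr (by simp [π, π', Labeling.extendLeft, Labeling.extendRight, hi])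
  exact ⟨_, le_rfl, π, π', (labeledInterleavingDist_le_iff h.nonneg).2 fun i j =>
    (hmatched i).abs_height_sup_sub_le (hmatched j)⟩

section transport

variable {ι : Type*} {p : ι → T.Point} {p' : ι → T'.Point} {δ : ℝ}

theorem height_le_add_of_height_sup_le_add
    (hsup : ∀ i j, (p' i ⊔ p' j).height ≤ (p i ⊔ p j).height + δ) (i : ι) :
    (p' i).height ≤ (p i).height + δ := by
  simpa only [sup_idem] using hsup i i

/-- The map that raises heights by `δ` and sends `x` to an ancestor of `p' i`, for a chosen `i` such
that `p i` is below `x`. If the height of `p' i` exceeds that of `x` by more than `δ`, then the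
value is `p' i`. -/
noncomputable def transport (hp : ∀ x, ∃ i, p i ≤ x) (p' : ι → T'.Point) (δ : ℝ) (x : T.Point) :
    T'.Point :=
  (p' (hp x).choose).ancestorAt (x.height + δ)

variable (hp : ∀ x, ∃ i, p i ≤ x)

theorem height_transport (hδ : ∀ i, (p' i).height ≤ (p i).height + δ) (x : T.Point) :
    (transport hp p' δ x).height = x.height + δ :=
  height_ancestorAt_of_le (by linarith [hδ (hp x).choose, height_mono (hp x).choose_spec])

theorem le_transport (hsup : ∀ i j, (p' i ⊔ p' j).height ≤ (p i ⊔ p j).height + δ) {i : ι}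
    {x : T.Point} (hi : p i ≤ x) : p' i ≤ transport hp p' δ x := by
  set j := (hp x).choose
  have hj : p j ≤ x := (hp x).choose_spec
  refine le_sup_left.trans (le_of_le_of_height_le (le_sup_right : p' j ≤ p' i ⊔ p' j)
    (le_ancestorAt _ _) ?_)
  rw [height_transport hp (height_le_add_of_height_sup_le_add hsup)]
  linarith [hsup i j, height_mono (sup_le hi hj)]

theorem monotone_transport (hsup : ∀ i j, (p' i ⊔ p' j).height ≤ (p i ⊔ p j).height + δ) :
    Monotone (transport hp p' δ) := by
  intro x y hxy
  obtain ⟨i, hi⟩ := hp x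
  refine le_of_le_of_height_le (le_transport hp hsup hi) (le_transport hp hsup (hi.trans hxy)) ?_
  simpa only [height_transport hp (height_le_add_of_height_sup_le_add hsup),
    add_le_add_iff_right] using height_mono hxy

theorem mem_range_transport (hsup : ∀ i j, (p' i ⊔ p' j).height ≤ (p i ⊔ p j).height + δ) {i : ι}
    {w : T'.Point} (hw : p' i ≤ w) (hheight : (p i).height + δ ≤ w.height) :
    w ∈ Set.range (transport hp p' δ) := by
  refine ⟨(p i).ancestorAt (w.height - δ),
    eq_of_le_of_height_eq (le_transport hp hsup ((p i).le_ancestorAt _)) hw ?_⟩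
  rw [height_transport hp (height_le_add_of_height_sup_le_add hsup),
    height_ancestorAt_of_le (le_sub_iff_add_le.2 hheight), sub_add_cancel]

theorem height_sup_le_of_transport_eq
    (hM : ∀ i j, |(p i ⊔ p j).height - (p' i ⊔ p' j).height| ≤ δ) {x y : T.Point}
    (hxy : transport hp p' δ x = transport hp p' δ y) : (x ⊔ y).height ≤ x.height + 2 * δ := by
  have hsup (i j) : (p' i ⊔ p' j).height ≤ (p i ⊔ p j).height + δ :=
    sub_le_iff_le_add'.1 (abs_sub_le_iff.1 (hM i j)).2
  have hheight := height_transport hp (height_le_add_of_height_sup_le_add hsup)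
  obtain ⟨i, hi⟩ := hp x
  obtain ⟨j, hj⟩ := hp y
  have hδ : 0 ≤ δ := (abs_nonneg _).trans (hM i i)
  have hyx : y.height = x.height := by
    linarith [hheight x, hheight y, congrArg Point.height hxy]
  have hpp' : (p i ⊔ p j).height ≤ (p' i ⊔ p' j).height + δ :=
    sub_le_iff_le_add'.1 (abs_sub_le_iff.1 (hM i j)).1
  have hp'x : (p' i ⊔ p' j).height ≤ x.height + δ := hheight x ▸
    height_mono (sup_le (le_transport hp hsup hi) ((le_transport hp hsup hj).trans_eq hxy.symm))
  refine (height_sup_le_max hi hj).trans (max_le ?_ (max_le ?_ ?_)) <;> linarith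

theorem isGood_transport (hp' : ∀ y, ∃ i, p' i ≤ y)
    (hM : ∀ i j, |(p i ⊔ p j).height - (p' i ⊔ p' j).height| ≤ δ) :
    IsGood T T' δ (transport hp p' δ) := by
  have hsup (i j) : (p' i ⊔ p' j).height ≤ (p i ⊔ p j).height + δ :=
    sub_le_iff_le_add'.1 (abs_sub_le_iff.1 (hM i j)).2
  refine IsGood.of_monotone
    (height_transport hp (height_le_add_of_height_sup_le_add hsup)) (monotone_transport hp hsup)
    (fun x y => height_sup_le_of_transport_eq hp hM) fun w hw u hu => ?_
  obtain ⟨i, hi⟩ := hp' u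
  have hpi : (p i).height ≤ (p' i).height + δ :=
    height_le_add_of_height_sup_le_add
      (fun j k => sub_le_iff_le_add'.1 (abs_sub_le_iff.1 (hM j k)).1) i
  by_contra! hlt
  exact hw (mem_range_transport hp hsup (hi.trans hu) (by linarith [height_mono hi]))

end transport

theorem exists_isGood_labeledInterleavingDist {n : ℕ} (π : Labeling T n) (π' : Labeling T' n) :
    ∃ α : T.Point → T'.Point, IsGood T T' (labeledInterleavingDist π π') α :=
  ⟨_, isGood_transport π.exists_toFun_le π'.exists_toFun_le
    ((labeledInterleavingDist_le_iff (labeledInterleavingDist_nonneg π π')).1 le_rfl)⟩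

theorem labeledDistSet_nonempty : (labeledDistSet T T').Nonempty :=
  ⟨_, _, le_rfl, .extendLeft fun _ => Classical.arbitrary _,
    .extendRight fun _ => Classical.arbitrary _, rfl⟩

theorem labeledDistSet_subset_goodSet : labeledDistSet T T' ⊆ goodSet T T' := by
  rintro _ ⟨n, -, π, π', rfl⟩
  exact exists_isGood_labeledInterleavingDist π π'

theorem lowerBounds_labeledDistSet :
    lowerBounds (labeledDistSet T T') = lowerBounds (goodSet T T') := by
  refine Set.Subset.antisymm ?_ (lowerBounds_mono_set labeledDistSet_subset_goodSet)
  rintro r hr δ ⟨α, hα⟩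
  obtain ⟨n, hn, π, π', hπ⟩ := hα.exists_labeledInterleavingDist_le
  exact (hr ⟨n, hn, π, π', rfl⟩).trans hπ

theorem isGLB_goodSet : IsGLB (goodSet T T') (interleavingDist T T') :=
  isGLB_csInf (labeledDistSet_nonempty.mono labeledDistSet_subset_goodSet)
    ⟨0, fun _ ⟨_, h⟩ => h.nonneg⟩

theorem isGLB_labeledDistSet : IsGLB (labeledDistSet T T') (interleavingDist T T') :=
  (isGLB_congr lowerBounds_labeledDistSet).2 isGLB_goodSet

end MergeTree

theorem mainTheorem2 (T : MergeTree.{u}) (T' : MergeTree.{v}) :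
    -- the two infima are over nonempty sets of reals that are bounded below, and they agree
    (IsGLB (MergeTree.goodSet T T') (MergeTree.interleavingDist T T') ∧
      IsGLB (MergeTree.labeledDistSet T T') (MergeTree.interleavingDist T T') ∧
      MergeTree.interleavingDist T T' = sInf (MergeTree.labeledDistSet T T')) ∧
    -- from good maps to labelings
    (∀ (δ : ℝ) (α : T.Point → T'.Point), MergeTree.IsGood T T' δ α →
      ∃ n ≤ T.leaves.ncard + T'.leaves.ncard,
        ∃ (π : MergeTree.Labeling T n) (π' : MergeTree.Labeling T' n),
          MergeTree.labeledInterleavingDist π π' ≤ δ) ∧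
    -- from labelings to good maps
    (∀ (n : ℕ) (π : MergeTree.Labeling T n) (π' : MergeTree.Labeling T' n),
      ∃ α : T.Point → T'.Point,
        MergeTree.IsGood T T' (MergeTree.labeledInterleavingDist π π') α) :=
  ⟨⟨MergeTree.isGLB_goodSet, MergeTree.isGLB_labeledDistSet,
      (MergeTree.isGLB_labeledDistSet.csInf_eq MergeTree.labeledDistSet_nonempty).symm⟩,
    fun _ _ h => h.exists_labeledInterleavingDist_le,
    fun _ π π' => MergeTree.exists_isGood_labeledInterleavingDist π π'⟩
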